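/- Let $m,N,s\ge 1$ be integers, $K\ge 1$ a real number, and let $A\in\mathbf C^{m\times N}$ be a random sampling matrix with bound $K$: its rows $X_1,\dots,X_m$ are independent random vectors in $\mathbf C^N$ (row vectors) with $\|X_j\|_\infty\le K$ almost surely and $\mathbb E[X_j^*X_j]=I_N$ for all $j$. For $0<\delta,\lambda<1$ put \[ C(\delta,\lambda)=\sqrt2\,\frac{2^5\mathrm e^{1/4}}{\ln 2}\,\frac{(\sqrt{\mathrm e}+\delta)^{1/2}}{(1-\lambda)\delta},\qquad D(\delta,\lambda)=2\,\frac{2^6\mathrm e^{3/2}(\delta+\sqrt{\mathrm e})}{(\delta\lambda)^2},\qquad p=\ln(2^{3/4}K^2s). \] Suppose $N>4p$, $0<\epsilon,\lambda<1$ and \[ \sqrt m> C\!\left(\tfrac4{\sqrt{41}},\lambda\right)K\sqrt s\,\ln^{1/2}(2^{3/4}K^2s)\,\ln\!\left(D\!\left(\tfrac4{\sqrt{41}},\lambda\right)K^2s\right)\ln^{1/2}(N/p)+C\!\left(\tfrac4{\sqrt{41}},\lambda\right)K\sqrt s\,\ln^{1/2}(1/\epsilon). \] Then with probability at least $1-\epsilon$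 the matrix $\frac1{\sqrt m}A$ satisfies the null space property of order $s$: for every $S\subset\{1,\dots,N\}$ with $|S|=s$ and every nonzero $\mathbf v\in\mathbf C^N$ with $\frac1{\sqrt m}A\mathbf v=0$, one has $\sum_{k\in S}|v_k|<\sum_{k\notin S}|v_k|$. -/

import Mathlib

open MeasureTheory ProbabilityTheory

noncomputable section

/-- Null space property of order `s`: `‖v_S‖₁ < ‖v_{Sᶜ}‖₁` for every set `S` of exactly `s`
column indices and every nonzero complex vector `v` in the kernel of `A`. -/
def NullSpaceProperty {m N : ℕ} (s : ℕ) (A : Matrix (Fin m) (Fin N) ℂ) : Prop :=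
  ∀ S : Finset (Fin N), S.card = s →
    ∀ v : Fin N → ℂ, A.mulVec v = 0 → v ≠ 0 →
      ∑ k ∈ S, ‖v k‖ < ∑ k ∈ Sᶜ, ‖v k‖

/-- Random sampling matrix with bound `K`: the rows `X_j` are independent random vectors in `ℂ^N`
(not necessarily identically distributed) with `‖X_j‖_∞ ≤ K` almost surely and
`E[X_j^* X_j] = I_N`. The norm on `Fin N → ℂ` is the sup norm. -/
structure IsRandomSamplingMatrix {Ω : Type*} [MeasurableSpace Ω] (μ : Measure Ω) {m N : ℕ}
    (K : ℝ) (A : Ω → Matrix (Fin m) (Fin N) ℂ) : Prop where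
  measurable_row : ∀ j : Fin m, Measurable fun ω => (A ω j : Fin N → ℂ)
  indep_rows : iIndepFun (fun (j : Fin m) (ω : Ω) => (A ω j : Fin N → ℂ)) μ
  bounded_row : ∀ j : Fin m, ∀ᵐ ω ∂μ, ‖(A ω j : Fin N → ℂ)‖ ≤ K
  isotropic_row : ∀ (j : Fin m) (k l : Fin N),
    ∫ ω, star (A ω j k) * A ω j l ∂μ = (1 : Matrix (Fin N) (Fin N) ℂ) k l

/-- `C₁(δ, lam) = (2⁵ e^{1/4} / ln 2) · (√e + δ)^{1/2} / ((1 - lam) δ)`. -/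
def samplingC₁ (δ lam : ℝ) : ℝ :=
  2 ^ 5 * Real.exp (1 / 4) / Real.log 2 *
    (√(√(Real.exp 1) + δ) / ((1 - lam) * δ))

/-- `C₂(δ, lam) = 2⁶ e^{3/2} (δ + √e) / (δ lam)²`. -/
def samplingC₂ (δ lam : ℝ) : ℝ :=
  2 ^ 6 * Real.exp (3 / 2) * (δ + √(Real.exp 1)) / (δ * lam) ^ 2

/-- `C(δ, lam) = √2 · C₁(δ, lam)`. -/
def samplingC (δ lam : ℝ) : ℝ := √2 * samplingC₁ δ lam

/-- `D(δ, lam) = 2 · C₂(δ, lam)`. -/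
def samplingD (δ lam : ℝ) : ℝ := 2 * samplingC₂ δ lam

/-- `p = ln(2^{3/4} K² s)`. -/
def samplingP (K : ℝ) (s : ℕ) : ℝ := Real.log ((2 : ℝ) ^ (3 / 4 : ℝ) * K ^ 2 * s)

end

/-! A kernel vector `v` violating the null space property can be scaled so that its real and
imaginary parts have total `ℓ¹` mass 1. Half or more of its `ℓ¹` norm sits on `s` coordinates, so
Cauchy–Schwarz gives `‖v‖₂² ≥ 1 / (8 s)`. By isotropy this is the mean of `|X_j · v|²`, a variable
bounded by `K²`. Hence at some dyadic level `i` the rows satisfy `|X_j · v|² > K² / 2 ^ (i + 1)`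
with average probability at least `θ i` (`exists_dyadic_level`), although every sampled row gives
exactly `0`.

To rule this out for all `v` at once, `x · v` is written as a convex combination of the `4N` atoms
`I ^ q * x_k` and replaced by an average of `k i` atoms (`exists_empirical_approx`). The replacement
fails only on a set that is small both for the row laws and for the sample. So one of at most `(4N)
^ k i` fixed sets is likely under the laws and yet hit by few sampled rows. For a fixed set
Chernoff's lower tail makes this exponentially unlikely (`measureReal_sum_indicator_le`), and a
union bound finishes. Only lower tails are needed, and the hypothesis on `m` makes the exponent
exceed the entropy `k i * log (4N)` at every level. -/

/-! ### Exponential potentials and the empirical method -/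

/-- A finite-average form of the exponential moment bound for bounded variables. -/
theorem sum_mul_exp_le {α : Type*} [Fintype α] (p y : α → ℝ) (hp : ∀ a, 0 ≤ p a)
    (hp1 : ∑ a, p a = 1) {b : ℝ} (hb : b ≤ 1) (hy : ∀ a, |y a| ≤ b) :
    ∑ a, p a * Real.exp (y a) ≤ Real.exp (∑ a, p a * y a + b ^ 2) := by
  have h1 : ∀ a, p a * Real.exp (y a) ≤ p a + p a * y a + p a * b ^ 2 := by
    intro a
    have h2 := (abs_le.1 (Real.abs_exp_sub_one_sub_id_le ((hy a).trans hb))).2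
    have h3 : y a ^ 2 ≤ b ^ 2 := sq_le_sq' (abs_le.1 (hy a)).1 (abs_le.1 (hy a)).2
    nlinarith [hp a]
  calc ∑ a, p a * Real.exp (y a) ≤ ∑ a, (p a + p a * y a + p a * b ^ 2) :=
        Finset.sum_le_sum fun a _ => h1 a
    _ = (∑ a, p a * y a + b ^ 2) + 1 := by
        rw [Finset.sum_add_distrib, Finset.sum_add_distrib, ← Finset.sum_mul, hp1]; ring
    _ ≤ _ := Real.add_one_le_exp _

/-- A complex number of modulus at least `t` has a large real part after rotation by a fourth root
of unity. -/
theorem exists_re_I_pow_mul_ge {z : ℂ} {t : ℝ} (h : t ≤ ‖z‖) :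
    ∃ q : Fin 4, t / √2 ≤ (Complex.I ^ (q : ℕ) * z).re := by
  have h2 : (0 : ℝ) < √2 := by positivity
  have hs : √2 * √2 = 2 := Real.mul_self_sqrt (by norm_num)
  rcases le_or_gt t 0 with ht | ht
  · have h0 : t / √2 ≤ 0 := div_nonpos_of_nonpos_of_nonneg ht h2.le
    rcases le_total 0 z.re with hr | hr
    · exact ⟨0, by simpa using h0.trans hr⟩
    · exact ⟨2, by simp [Complex.I_sq]; linarith⟩
  have hn : ‖z‖ ^ 2 = z.re ^ 2 + z.im ^ 2 := by
    rw [← Complex.normSq_eq_norm_sq, Complex.normSq_apply]; ring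
  have hc : t ^ 2 / 2 ≤ z.re ^ 2 ∨ t ^ 2 / 2 ≤ z.im ^ 2 := by
    by_contra! hcon
    nlinarith
  have hd : (t / √2) ^ 2 = t ^ 2 / 2 := by rw [div_pow, Real.sq_sqrt (by norm_num)]
  have hI3 : Complex.I ^ 3 = -Complex.I := by rw [pow_succ, Complex.I_sq]; simp
  have key : ∀ r : ℝ, t ^ 2 / 2 ≤ r ^ 2 → t / √2 ≤ r ∨ t / √2 ≤ -r := by
    intro r hr
    have := sq_le_sq.1 (hd.le.trans hr)
    rw [abs_of_pos (div_pos ht h2)] at this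
    exact le_abs.1 this
  rcases hc with hc | hc <;> rcases key _ hc with hk | hk
  · exact ⟨0, by simpa using hk⟩
  · exact ⟨2, by simpa [Complex.I_sq] using hk⟩
  · exact ⟨3, by simpa [hI3] using hk⟩
  · exact ⟨1, by simpa using hk⟩

/-- One averaging step for the exponential potential. -/
theorem sum_mul_exp_re_le {α : Type*} [Fintype α] (p : α → ℝ) (hp : ∀ a, 0 ≤ p a)
    (hp1 : ∑ a, p a = 1) (g : α → ℂ) {K l : ℝ} (hl : 0 ≤ l) (hlK : l * K ≤ 1)
    (hg : ∀ a, ‖g a‖ ≤ K) (c S : ℂ) (hc : ‖c‖ = 1) :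
    ∑ a, p a * Real.exp (l * (c * (S + (g a - ∑ b, (p b : ℂ) * g b))).re) ≤
      Real.exp ((l * K) ^ 2) * Real.exp (l * (c * S).re) := by
  have hy : ∀ a, |l * (c * g a).re| ≤ l * K := by
    intro a
    rw [abs_mul, abs_of_nonneg hl]
    refine mul_le_mul_of_nonneg_left ((Complex.abs_re_le_norm _).trans ?_) hl
    rw [norm_mul, hc, one_mul]; exact hg a
  have hmean : (c * ∑ b, (p b : ℂ) * g b).re = ∑ b, p b * (c * g b).re := by
    rw [Finset.mul_sum, Complex.re_sum]
    refine Finset.sum_congr rfl fun b _ => ?_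
    rw [mul_left_comm, Complex.re_ofReal_mul]
  have hsplit : ∀ a, Real.exp (l * (c * (S + (g a - ∑ b, (p b : ℂ) * g b))).re) =
      Real.exp (l * (c * S).re) * Real.exp (-(l * (c * ∑ b, (p b : ℂ) * g b).re)) *
        Real.exp (l * (c * g a).re) := by
    intro a
    rw [← Real.exp_add, ← Real.exp_add, mul_add, mul_sub, Complex.add_re, Complex.sub_re]
    congr 1; ring
  have h := sum_mul_exp_le p (fun a => l * (c * g a).re) hp hp1 hlK hy
  have hm2 : ∑ a, p a * (l * (c * g a).re) = l * (c * ∑ b, (p b : ℂ) * g b).re := by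
    rw [hmean, Finset.mul_sum]; exact Finset.sum_congr rfl fun a _ => by ring
  rw [hm2, Real.exp_add] at h
  calc _ = Real.exp (l * (c * S).re) * Real.exp (-(l * (c * ∑ b, (p b : ℂ) * g b).re)) *
        ∑ a, p a * Real.exp (l * (c * g a).re) := by
        rw [Finset.mul_sum]
        exact Finset.sum_congr rfl fun a _ => by rw [hsplit]; ring
    _ ≤ Real.exp (l * (c * S).re) * Real.exp (-(l * (c * ∑ b, (p b : ℂ) * g b).re)) *
        (Real.exp (l * (c * ∑ b, (p b : ℂ) * g b).re) * Real.exp ((l * K) ^ 2)) :=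
        mul_le_mul_of_nonneg_left h (by positivity)
    _ = _ := by
        rw [Real.exp_neg]; field_simp

/-- The exponential potential used to derandomise empirical approximation. -/
noncomputable def expPotential (l : ℝ) (z : ℂ) : ℝ :=
  ∑ q : Fin 4, Real.exp (l * (Complex.I ^ (q : ℕ) * z).re)

theorem expPotential_nonneg (l : ℝ) (z : ℂ) : 0 ≤ expPotential l z :=
  Finset.sum_nonneg fun _ _ => (Real.exp_pos _).le

theorem continuous_expPotential (l : ℝ) : Continuous (expPotential l) := by
  unfold expPotential; fun_prop

theorem exp_le_expPotential {l t : ℝ} (hl : 0 ≤ l) {z : ℂ} (h : t ≤ ‖z‖) :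
    Real.exp (l * (t / √2)) ≤ expPotential l z := by
  obtain ⟨q, hq⟩ := exists_re_I_pow_mul_ge h
  refine le_trans ?_ (Finset.single_le_sum (f := fun q : Fin 4 =>
    Real.exp (l * (Complex.I ^ (q : ℕ) * z).re)) (fun _ _ => (Real.exp_pos _).le)
    (Finset.mem_univ q))
  exact Real.exp_le_exp.2 (mul_le_mul_of_nonneg_left hq hl)

theorem sum_mul_expPotential_le {α : Type*} [Fintype α] (p : α → ℝ) (hp : ∀ a, 0 ≤ p a)
    (hp1 : ∑ a, p a = 1) (g : α → ℂ) {K l : ℝ} (hl : 0 ≤ l) (hlK : l * K ≤ 1)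
    (hg : ∀ a, ‖g a‖ ≤ K) (S : ℂ) :
    ∑ a, p a * expPotential l (S + (g a - ∑ b, (p b : ℂ) * g b)) ≤
      Real.exp ((l * K) ^ 2) * expPotential l S := by
  simp only [expPotential, Finset.mul_sum]
  rw [Finset.sum_comm]
  exact Finset.sum_le_sum fun q _ =>
    sum_mul_exp_re_le p hp hp1 g hl hlK hg _ S (by simp)

/-- Method of conditional expectations. Averaged over the next atom, the potential grows pointwise
by at most `exp ((l * K) ^ 2)`; after integrating against `ρ`, some single atom does no worse than
the average. The factor 4 is the potential at the empty sum. -/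
theorem exists_sum_lintegral_expPotential_le {X α : Type*} [MeasurableSpace X] [Fintype α]
    (ρ : Measure X) (p : α → ℝ) (hp : ∀ a, 0 ≤ p a)
    (hp1 : ∑ a, p a = 1) (g : α → X → ℂ) (hgm : ∀ a, Measurable (g a)) {K l : ℝ} (hl : 0 ≤ l)
    (hlK : l * K ≤ 1) (hg : ∀ᵐ x ∂ρ, ∀ a, ‖g a x‖ ≤ K) (k : ℕ) :
    ∃ f : Fin k → α,
      ∫⁻ x, ENNReal.ofReal (expPotential l (∑ i, (g (f i) x - ∑ b, (p b : ℂ) * g b x))) ∂ρ ≤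
        ENNReal.ofReal (Real.exp (k * (l * K) ^ 2)) * (4 * ρ Set.univ) := by
  induction k with
  | zero =>
    refine ⟨Fin.elim0, ?_⟩
    simp [expPotential]
  | succ k ih =>
    obtain ⟨f, hf⟩ := ih
    set S : X → ℂ := fun x => ∑ i, (g (f i) x - ∑ b, (p b : ℂ) * g b x) with hS
    have hSm : Measurable S := by fun_prop
    have hm : ∀ a, Measurable fun x =>
        ENNReal.ofReal (expPotential l (S x + (g a x - ∑ b, (p b : ℂ) * g b x))) := by
      intro a
      refine ENNReal.measurable_ofReal.comp ((continuous_expPotential l).measurable.comp ?_)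
      fun_prop
    set G : α → ENNReal := fun a =>
      ∫⁻ x, ENNReal.ofReal (expPotential l (S x + (g a x - ∑ b, (p b : ℂ) * g b x))) ∂ρ with hG
    set T := ENNReal.ofReal (Real.exp ((k + 1 : ℕ) * (l * K) ^ 2)) * (4 * ρ Set.univ) with hT
    have hsum : ∑ a, ENNReal.ofReal (p a) * G a ≤ T := by
      calc ∑ a, ENNReal.ofReal (p a) * G a
          = ∫⁻ x, ENNReal.ofReal (∑ a, p a *
              expPotential l (S x + (g a x - ∑ b, (p b : ℂ) * g b x))) ∂ρ := by
            rw [← Finset.sum_congr rfl fun a _ => lintegral_const_mul (ENNReal.ofReal (p a)) (hm a),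
              ← lintegral_finsetSum _ fun a _ => (hm a).const_mul _]
            refine lintegral_congr fun x => ?_
            rw [ENNReal.ofReal_sum_of_nonneg fun a _ =>
              mul_nonneg (hp a) (expPotential_nonneg _ _)]
            exact Finset.sum_congr rfl fun a _ => (ENNReal.ofReal_mul (hp a)).symm
        _ ≤ ∫⁻ x, ENNReal.ofReal (Real.exp ((l * K) ^ 2)) *
              ENNReal.ofReal (expPotential l (S x)) ∂ρ := by
            refine lintegral_mono_ae (hg.mono fun x hx => ?_)
            rw [← ENNReal.ofReal_mul (Real.exp_pos _).le]
            exact ENNReal.ofReal_le_ofReal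
              (sum_mul_expPotential_le p hp hp1 (fun a => g a x) hl hlK hx (S x))
        _ = ENNReal.ofReal (Real.exp ((l * K) ^ 2)) *
              ∫⁻ x, ENNReal.ofReal (expPotential l (S x)) ∂ρ :=
            lintegral_const_mul _
              (ENNReal.measurable_ofReal.comp ((continuous_expPotential l).measurable.comp hSm))
        _ ≤ ENNReal.ofReal (Real.exp ((l * K) ^ 2)) *
              (ENNReal.ofReal (Real.exp (k * (l * K) ^ 2)) * (4 * ρ Set.univ)) := by gcongr
        _ = T := by
            rw [hT, ← mul_assoc, ← ENNReal.ofReal_mul (Real.exp_pos _).le, ← Real.exp_add]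
            congr 3; push_cast; ring
    have hne : Nonempty α := by
      by_contra h0
      rw [not_nonempty_iff] at h0
      simp at hp1
    obtain ⟨a, ha⟩ := Finite.exists_min G
    have haT : G a ≤ T := by
      refine le_trans (le_of_eq_of_le ?_ (Finset.sum_le_sum fun b _ =>
        mul_le_mul_right (ha b) (ENNReal.ofReal (p b)))) hsum
      rw [← Finset.sum_mul, ← ENNReal.ofReal_sum_of_nonneg fun a _ => hp a, hp1]; simp
    refine ⟨Fin.snoc f a, ?_⟩
    simpa only [Fin.sum_univ_castSucc, Fin.snoc_castSucc, Fin.snoc_last] using haT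

/-- Maurey's empirical method with exponential tails: an average of elements of a bounded family is
approximated, outside a set of exponentially small measure, by an average of `k` members. -/
theorem exists_empirical_approx {X α : Type*} [MeasurableSpace X] [Fintype α]
    (ρ : Measure X) [IsFiniteMeasure ρ] (p : α → ℝ) (hp : ∀ a, 0 ≤ p a)
    (hp1 : ∑ a, p a = 1) (g : α → X → ℂ) (hgm : ∀ a, Measurable (g a)) {K t : ℝ} (hK : 0 < K)
    (ht : 0 ≤ t) (htK : t ≤ K) (hg : ∀ᵐ x ∂ρ, ∀ a, ‖g a x‖ ≤ K) (k : ℕ) (hk : 0 < k) :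
    ∃ f : Fin k → α,
      ρ.real {x | t ≤ ‖∑ b, (p b : ℂ) * g b x - (k : ℂ)⁻¹ * ∑ i, g (f i) x‖} ≤
        4 * ρ.real Set.univ * Real.exp (-(k * t ^ 2 / (8 * K ^ 2))) := by
  -- This `l` minimises the exponent `k * (l * K) ^ 2 - l * k * t / √2`, with value `-k * t ^ 2 / (8
  -- * K ^ 2)`; `t ≤ K` ensures `l * K ≤ 1`.
  set l : ℝ := t / √2 / (2 * K ^ 2) with hl
  have h2 : (1 : ℝ) ≤ √2 := Real.one_le_sqrt.2 (by norm_num)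
  have hl0 : 0 ≤ l := by positivity
  have ht2 : t / √2 ≤ t := div_le_self ht h2
  have hlK : l * K ≤ 1 := by
    have : l * K = t / √2 / (2 * K) := by rw [hl]; field_simp
    rw [this, div_le_one (by positivity)]
    linarith
  obtain ⟨f, hf⟩ := exists_sum_lintegral_expPotential_le ρ p hp hp1 g hgm hl0 hlK hg k
  refine ⟨f, ?_⟩
  set Z : X → ℂ := fun x => ∑ i, (g (f i) x - ∑ b, (p b : ℂ) * g b x) with hZ
  have hZm : Measurable Z := by fun_prop
  have hk' : (0 : ℝ) < k := by exact_mod_cast hk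
  have hnorm : ∀ x, ‖Z x‖ = k * ‖∑ b, (p b : ℂ) * g b x - (k : ℂ)⁻¹ * ∑ i, g (f i) x‖ := by
    intro x
    have hkc : (k : ℂ) ≠ 0 := by exact_mod_cast hk.ne'
    have : Z x = -((k : ℂ) * (∑ b, (p b : ℂ) * g b x - (k : ℂ)⁻¹ * ∑ i, g (f i) x)) := by
      simp only [hZ, Finset.sum_sub_distrib, Finset.sum_const, Finset.card_univ,
        Fintype.card_fin, nsmul_eq_mul]
      field_simp; ring
    rw [this, norm_neg, norm_mul, Complex.norm_natCast]
  have hmark := mul_meas_ge_le_lintegral (μ := ρ)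
    (ENNReal.measurable_ofReal.comp ((continuous_expPotential l).measurable.comp hZm))
    (ENNReal.ofReal (Real.exp (l * (k * t / √2))))
  have hsub : {x | t ≤ ‖∑ b, (p b : ℂ) * g b x - (k : ℂ)⁻¹ * ∑ i, g (f i) x‖} ⊆
      {x | ENNReal.ofReal (Real.exp (l * (k * t / √2))) ≤
        (ENNReal.ofReal ∘ expPotential l ∘ Z) x} := by
    intro x hx
    refine ENNReal.ofReal_le_ofReal (exp_le_expPotential hl0 ?_)
    rw [hnorm]
    exact mul_le_mul_of_nonneg_left hx hk'.le
  have hmain := (mul_le_mul_right (measure_mono (μ := ρ) hsub)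
    (ENNReal.ofReal (Real.exp (l * (k * t / √2))))).trans (hmark.trans hf)
  have hreal := ENNReal.toReal_mono (by finiteness) hmain
  rw [ENNReal.toReal_mul, ENNReal.toReal_mul, ENNReal.toReal_mul,
    ENNReal.toReal_ofReal (Real.exp_pos _).le, ENNReal.toReal_ofReal (Real.exp_pos _).le] at hreal
  change Real.exp _ * ρ.real _ ≤ Real.exp _ * (_ * ρ.real _) at hreal
  have hexp : -(k * t ^ 2 / (8 * K ^ 2)) = k * (l * K) ^ 2 - l * (k * t / √2) := by
    rw [hl]
    have hs : √2 ^ 2 = 2 := Real.sq_sqrt (by norm_num)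
    field_simp
    rw [hs]; ring
  rw [hexp, Real.exp_sub, mul_div_assoc', le_div_iff₀ (Real.exp_pos _)]
  simp only [ENNReal.toReal_ofNat] at hreal
  linarith

/-! ### Lower tail for hit counts -/

/-- Multiplicative Chernoff lower tail for the number of independent variables that hit a set. -/
theorem measureReal_sum_indicator_le {Ω E ι : Type*} [MeasurableSpace Ω] [MeasurableSpace E]
    [Fintype ι] (μ : Measure Ω) [IsProbabilityMeasure μ] (X : ι → Ω → E)
    (hX : ∀ j, Measurable (X j)) (hind : iIndepFun X μ) {B : Set E} (hB : MeasurableSet B)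
    {T : ℝ} (hT : 0 ≤ T) (h : 3 / 4 * T ≤ ∑ j, μ.real (X j ⁻¹' B)) :
    μ.real {ω | ∑ j, B.indicator (fun _ => (1 : ℝ)) (X j ω) ≤ T / 4} ≤
      Real.exp (-(11 / 50 * T)) := by
  set φ : E → ℝ := B.indicator (fun _ => (1 : ℝ)) with hφ
  have hφm : Measurable φ := measurable_const.indicator hB
  have hφ0 : ∀ x, 0 ≤ φ x := fun x => Set.indicator_nonneg (fun _ _ => zero_le_one) x
  set Y : ι → Ω → ℝ := fun j => φ ∘ X j with hY
  have hYm : ∀ j, Measurable (Y j) := fun j => hφm.comp (hX j)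
  have hYind : iIndepFun Y μ := hind.comp (fun _ => φ) (fun _ => hφm)
  -- Chernoff with parameter `-1`: the exponent is at most `T / 4 - d * (3 / 4) * T`, and `d ≥ 0.63`
  -- makes this at most `-0.22 * T`.
  set d : ℝ := 1 - Real.exp (-1) with hd
  have hd1 : 63 / 100 ≤ d := by
    have := Real.exp_neg_one_lt_d9
    rw [hd]; linarith
  have hmgf : ∀ j, mgf (Y j) μ (-1) ≤ Real.exp (-(d * μ.real (X j ⁻¹' B))) := by
    intro j
    have hpre : MeasurableSet (X j ⁻¹' B) := hX j hB
    have hpt : ∀ ω, Real.exp (-1 * Y j ω) = 1 - d * (X j ⁻¹' B).indicator (fun _ => (1 : ℝ)) ω := by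
      intro ω
      by_cases hω : X j ω ∈ B
      · simp [hY, hφ, hω, hd]
      · simp [hY, hφ, hω]
    have hmg : mgf (Y j) μ (-1) = 1 - d * μ.real (X j ⁻¹' B) := by
      rw [mgf]
      simp_rw [hpt]
      rw [integral_sub (integrable_const _)
        (((integrable_const (1 : ℝ)).indicator hpre).const_mul d), integral_const_mul,
        integral_indicator_const _ hpre]
      simp
    rw [hmg]
    have := Real.add_one_le_exp (-(d * μ.real (X j ⁻¹' B)))
    linarith
  have hsumfun : ∀ ω, (∑ j, Y j) ω = ∑ j, φ (X j ω) := fun ω => by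
    simp [Finset.sum_apply, hY]
  have hint : Integrable (fun ω => Real.exp (-1 * (∑ j, Y j) ω)) μ := by
    refine Integrable.of_bound (C := 1) ?_ (Filter.Eventually.of_forall fun ω => ?_)
    · have : Measurable (∑ j, Y j) := by fun_prop
      exact (Real.measurable_exp.comp (this.const_mul (-1))).aestronglyMeasurable
    · rw [Real.norm_eq_abs, Real.abs_exp, Real.exp_le_one_iff, hsumfun]
      have := Finset.sum_nonneg fun j (_ : j ∈ Finset.univ) => hφ0 (X j ω)
      linarith
  have hch := measure_le_le_exp_mul_mgf (μ := μ) (X := ∑ j, Y j) (t := -1) (T / 4)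
    (by norm_num) hint
  simp only [hsumfun] at hch
  refine hch.trans ?_
  rw [hYind.mgf_sum hYm]
  calc Real.exp (- -1 * (T / 4)) * ∏ j, mgf (Y j) μ (-1)
      ≤ Real.exp (- -1 * (T / 4)) * ∏ j, Real.exp (-(d * μ.real (X j ⁻¹' B))) :=
        mul_le_mul_of_nonneg_left
          (Finset.prod_le_prod (fun j _ => mgf_nonneg) fun j _ => hmgf j) (Real.exp_pos _).le
    _ = Real.exp (T / 4 - d * ∑ j, μ.real (X j ⁻¹' B)) := by
        rw [← Real.exp_sum, ← Real.exp_add, Finset.mul_sum, Finset.sum_neg_distrib]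
        congr 1; ring
    _ ≤ _ := by
        refine Real.exp_le_exp.2 ?_
        nlinarith

/-! ### Dyadic levels of a bounded function -/

/-- Dyadic layer bound: a number in `[0, b]` is dominated by its dyadic level indicators. -/
theorem le_sum_dyadic_indicator {b y : ℝ} (hb : 0 ≤ b) (hy : y ≤ b) (n : ℕ) :
    y ≤ b / 2 ^ n +
      ∑ i ∈ Finset.range n, b / 2 ^ i * (Set.Ioi (b / 2 ^ (i + 1))).indicator (fun _ => (1 : ℝ)) y := by
  induction n with
  | zero => simpa using hy
  | succ n ih =>
    have h0 : ∀ i ∈ Finset.range (n + 1), 0 ≤ b / 2 ^ i *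
        (Set.Ioi (b / 2 ^ (i + 1))).indicator (fun _ => (1 : ℝ)) y := fun i _ =>
      mul_nonneg (by positivity) (Set.indicator_nonneg (fun _ _ => zero_le_one) y)
    rcases le_or_gt y (b / 2 ^ (n + 1)) with h | h
    · have := Finset.sum_nonneg h0
      linarith
    -- The new indicator equals 1, so its term `b / 2 ^ n` replaces the remainder in the induction
    -- hypothesis.
    · rw [Finset.sum_range_succ, Set.indicator_of_mem (Set.mem_Ioi.2 h), mul_one]
      have : 0 ≤ b / 2 ^ (n + 1) := by positivity
      linarith

/-- If a bounded function has a large mean, then at some dyadic level it is large on a set of large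
measure. -/
theorem exists_dyadic_level {X : Type*} [MeasurableSpace X] (ρ : Measure X) [IsFiniteMeasure ρ]
    (Y : X → ℝ) (hY : Measurable Y) {b σ : ℝ} (hb : 0 ≤ b) (hσ : 0 ≤ σ) (hY0 : ∀ x, 0 ≤ Y x)
    (hYb : ∀ᵐ x ∂ρ, Y x ≤ b) (hmean : ρ.real Set.univ * σ ≤ ∫ x, Y x ∂ρ) {n : ℕ} (hn : 0 < n)
    (hbn : b / 2 ^ n ≤ σ / 2) (α : ℕ → ℝ) (hα : ∑ i ∈ Finset.range n, α i ≤ 1 / 2) :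
    ∃ i < n, α i * (ρ.real Set.univ * σ) ≤ b / 2 ^ i * ρ.real {x | b / 2 ^ (i + 1) < Y x} := by
  have hms : ∀ i : ℕ, MeasurableSet {x | b / 2 ^ (i + 1) < Y x} := fun i =>
    measurableSet_lt measurable_const hY
  have hind : ∀ (i : ℕ) x, (Set.Ioi (b / 2 ^ (i + 1))).indicator (fun _ => (1 : ℝ)) (Y x) =
      {x | b / 2 ^ (i + 1) < Y x}.indicator (fun _ => (1 : ℝ)) x := fun i x => rfl
  have hint : ∀ i : ℕ, Integrable (fun x => b / 2 ^ i *
      (Set.Ioi (b / 2 ^ (i + 1))).indicator (fun _ => (1 : ℝ)) (Y x)) ρ := fun i => by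
    simp_rw [hind]
    exact ((integrable_const (1 : ℝ)).indicator (hms i)).const_mul _
  have hYi : Integrable Y ρ := Integrable.of_bound hY.aestronglyMeasurable b
    (hYb.mono fun x hx => by rwa [Real.norm_eq_abs, abs_of_nonneg (hY0 x)])
  have hle : ∫ x, Y x ∂ρ ≤ b / 2 ^ n * ρ.real Set.univ +
      ∑ i ∈ Finset.range n, b / 2 ^ i * ρ.real {x | b / 2 ^ (i + 1) < Y x} := by
    calc ∫ x, Y x ∂ρ ≤ ∫ x, (b / 2 ^ n + ∑ i ∈ Finset.range n, b / 2 ^ i *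
          (Set.Ioi (b / 2 ^ (i + 1))).indicator (fun _ => (1 : ℝ)) (Y x)) ∂ρ :=
          integral_mono_ae hYi ((integrable_const _).add (integrable_finsetSum _ fun i _ => hint i))
            (hYb.mono fun x hx => le_sum_dyadic_indicator hb hx n)
      _ = _ := by
          rw [integral_add (integrable_const _) (integrable_finsetSum _ fun i _ => hint i),
            integral_finsetSum _ fun i _ => hint i, integral_const, smul_eq_mul,
            mul_comm (ρ.real Set.univ)]
          congr 1
          refine Finset.sum_congr rfl fun i _ => ?_
          simp_rw [hind]
          rw [integral_const_mul, integral_indicator_const _ (hms i), smul_eq_mul, mul_one]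
  have hm0 : 0 ≤ ρ.real Set.univ := measureReal_nonneg
  -- The remainder `b / 2 ^ n` uses at most half of the mean; the weights `α` share out at most the
  -- other half, so some level carries its share.
  have hcmp : ∑ i ∈ Finset.range n, α i * (ρ.real Set.univ * σ) ≤
      ∑ i ∈ Finset.range n, b / 2 ^ i * ρ.real {x | b / 2 ^ (i + 1) < Y x} := by
    rw [← Finset.sum_mul]
    have h1 := mul_le_mul_of_nonneg_right hα (mul_nonneg hm0 hσ)
    have h2 := mul_le_mul_of_nonneg_right hbn hm0
    linarith
  obtain ⟨i, hi, h⟩ := Finset.exists_le_of_sum_le ⟨0, Finset.mem_range.2 hn⟩ hcmp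
  exact ⟨i, Finset.mem_range.1 hi, h⟩

/-! ### Atoms, violating vectors and isotropy -/

/-- The coordinate functional at `a.1`, rotated by the fourth root of unity `I ^ a.2`. -/
noncomputable def atomEval {N : ℕ} (a : Fin N × Fin 4) (x : Fin N → ℂ) : ℂ :=
  Complex.I ^ (a.2 : ℕ) * x a.1

/-- The nonnegative coefficients of a complex number on the fourth roots of unity. -/
noncomputable def quadrantWeight (z : ℂ) : Fin 4 → ℝ :=
  ![max z.re 0, max z.im 0, max (-z.re) 0, max (-z.im) 0]

theorem quadrantWeight_nonneg (z : ℂ) (q : Fin 4) : 0 ≤ quadrantWeight z q := by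
  fin_cases q <;> simp [quadrantWeight]

theorem sum_quadrantWeight (z : ℂ) : ∑ q, quadrantWeight z q = |z.re| + |z.im| := by
  have h : ∀ r : ℝ, max r 0 + max (-r) 0 = |r| := fun r => by
    rcases le_total 0 r with hr | hr <;> simp [hr, abs_of_nonneg, abs_of_nonpos]
  rw [← h z.re, ← h z.im]
  simp only [Fin.sum_univ_four, quadrantWeight, Matrix.cons_val]
  ring

theorem sum_quadrantWeight_mul (z : ℂ) :
    ∑ q : Fin 4, (quadrantWeight z q : ℂ) * Complex.I ^ (q : ℕ) = z := by
  have h : ∀ r : ℝ, max r 0 - max (-r) 0 = r := fun r => by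
    rcases le_total 0 r with hr | hr <;> simp [hr]
  have hI3 : Complex.I ^ 3 = -Complex.I := by rw [pow_succ, Complex.I_sq]; simp
  conv_rhs => rw [← Complex.re_add_im z, ← h z.re, ← h z.im]
  simp only [Fin.sum_univ_four, quadrantWeight, Matrix.cons_val,
    Fin.coe_ofNat_eq_mod, pow_zero, pow_one, Nat.reduceMod, hI3, Complex.I_sq]
  push_cast
  ring

/-- With `sum_quadrantWeight`, this makes `x ⬝ᵥ v` a convex combination of atoms once the real and
imaginary parts of `v` have total mass 1, as the empirical method requires. -/
theorem sum_quadrantWeight_mul_atomEval {N : ℕ} (v x : Fin N → ℂ) :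
    ∑ a : Fin N × Fin 4, (quadrantWeight (v a.1) a.2 : ℂ) * atomEval a x = x ⬝ᵥ v := by
  rw [Fintype.sum_prod_type, dotProduct]
  refine Finset.sum_congr rfl fun k _ => ?_
  conv_rhs => rw [← sum_quadrantWeight_mul (v k), Finset.mul_sum]
  exact Finset.sum_congr rfl fun q _ => by simp only [atomEval]; ring

theorem norm_atomEval_le {N : ℕ} (a : Fin N × Fin 4) (x : Fin N → ℂ) : ‖atomEval a x‖ ≤ ‖x‖ := by
  simpa [atomEval] using norm_le_pi_norm x a.1

theorem measurable_atomEval {N : ℕ} (a : Fin N × Fin 4) : Measurable (atomEval a) := by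
  unfold atomEval; fun_prop

theorem abs_re_add_abs_im_le (z : ℂ) : |z.re| + |z.im| ≤ √2 * ‖z‖ := by
  have h : ‖z‖ ^ 2 = |z.re| ^ 2 + |z.im| ^ 2 := by
    rw [← Complex.normSq_eq_norm_sq, Complex.normSq_apply, sq_abs, sq_abs]; ring
  refine abs_le_of_sq_le_sq' ?_ (by positivity) |>.2
  rw [mul_pow, Real.sq_sqrt (by norm_num), h]
  nlinarith [sq_nonneg (|z.re| - |z.im|)]

/-- A vector concentrated in `ℓ¹` on few coordinates has large Euclidean norm. -/
theorem one_le_sum_norm_sq {N s : ℕ} (S : Finset (Fin N)) (hS : S.card = s) (v : Fin N → ℂ)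
    (hv : ∑ k, (|(v k).re| + |(v k).im|) = 1) (hSv : ∑ k ∈ Sᶜ, ‖v k‖ ≤ ∑ k ∈ S, ‖v k‖) :
    1 ≤ 8 * s * ∑ k, ‖v k‖ ^ 2 := by
  -- Squaring the factor `2 * √2` gives the constant 8; Cauchy–Schwarz on `S` supplies `s`.
  have h1 : 1 ≤ √2 * (2 * ∑ k ∈ S, ‖v k‖) := by
    rw [← hv]
    calc _ ≤ ∑ k, √2 * ‖v k‖ := Finset.sum_le_sum fun k _ => abs_re_add_abs_im_le _
      _ = √2 * (∑ k ∈ S, ‖v k‖ + ∑ k ∈ Sᶜ, ‖v k‖) := by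
        rw [← Finset.mul_sum, Finset.sum_add_sum_compl]
      _ ≤ _ := mul_le_mul_of_nonneg_left (by linarith) (Real.sqrt_nonneg _)
  have h2 : 1 ≤ 8 * (∑ k ∈ S, ‖v k‖) ^ 2 := by
    have := pow_le_pow_left₀ zero_le_one h1 2
    rw [mul_pow, Real.sq_sqrt (by norm_num)] at this
    linarith
  have h3 : (∑ k ∈ S, ‖v k‖) ^ 2 ≤ s * ∑ k ∈ S, ‖v k‖ ^ 2 := hS ▸ sq_sum_le_card_mul_sum_sq
  have h4 : ∑ k ∈ S, ‖v k‖ ^ 2 ≤ ∑ k, ‖v k‖ ^ 2 :=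
    Finset.sum_le_sum_of_subset_of_nonneg (Finset.subset_univ S) fun _ _ _ => by positivity
  have h5 : (s : ℝ) * ∑ k ∈ S, ‖v k‖ ^ 2 ≤ s * ∑ k, ‖v k‖ ^ 2 :=
    mul_le_mul_of_nonneg_left h4 (Nat.cast_nonneg s)
  linarith

theorem norm_dotProduct_le {N : ℕ} (v x : Fin N → ℂ)
    (hv : ∑ k, (|(v k).re| + |(v k).im|) = 1) : ‖x ⬝ᵥ v‖ ≤ ‖x‖ := by
  calc ‖x ⬝ᵥ v‖ ≤ ∑ k, ‖x k * v k‖ := norm_sum_le _ _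
    _ ≤ ∑ k, ‖x‖ * (|(v k).re| + |(v k).im|) := Finset.sum_le_sum fun k _ => by
        rw [norm_mul]
        exact mul_le_mul (norm_le_pi_norm x k) (Complex.norm_le_abs_re_add_abs_im _)
          (norm_nonneg _) (norm_nonneg _)
    _ = ‖x‖ := by rw [← Finset.mul_sum, hv, mul_one]

/-- Isotropy: the second moment of a linear functional is the squared Euclidean norm. -/
theorem IsRandomSamplingMatrix.integral_norm_sq {Ω : Type*} [MeasurableSpace Ω] {μ : Measure Ω}
    [IsProbabilityMeasure μ] {m N : ℕ} {K : ℝ} {A : Ω → Matrix (Fin m) (Fin N) ℂ}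
    (hA : IsRandomSamplingMatrix μ K A) (j : Fin m) (v : Fin N → ℂ) :
    ∫ ω, ‖A ω j ⬝ᵥ v‖ ^ 2 ∂μ = ∑ k, ‖v k‖ ^ 2 := by
  have hmeas : ∀ k, Measurable fun ω => A ω j k := fun k =>
    (measurable_pi_apply k).comp (hA.measurable_row j)
  have hint : ∀ k l, Integrable (fun ω => star (A ω j k) * A ω j l) μ := by
    intro k l
    refine Integrable.of_bound (C := K * K) ?_ ((hA.bounded_row j).mono fun ω hω => ?_)
    · exact ((Complex.continuous_conj.measurable.comp (hmeas k)).mul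
        (hmeas l)).aestronglyMeasurable
    · have h1 := (norm_le_pi_norm (A ω j) k).trans hω
      have h2 := (norm_le_pi_norm (A ω j) l).trans hω
      rw [norm_mul, norm_star]
      exact mul_le_mul h1 h2 (norm_nonneg _) ((norm_nonneg _).trans h1)
  have hpt : ∀ ω, ((‖A ω j ⬝ᵥ v‖ ^ 2 : ℝ) : ℂ) =
      ∑ k, ∑ l, star (v k) * v l * (star (A ω j k) * A ω j l) := by
    intro ω
    rw [← Complex.normSq_eq_norm_sq, Complex.normSq_eq_conj_mul_self, dotProduct, map_sum,
      Finset.sum_mul_sum]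
    refine Finset.sum_congr rfl fun k _ => Finset.sum_congr rfl fun l _ => ?_
    rw [map_mul]
    simp only [starRingEnd_apply]
    ring
  have hc : ((∫ ω, ‖A ω j ⬝ᵥ v‖ ^ 2 ∂μ : ℝ) : ℂ) = ((∑ k, ‖v k‖ ^ 2 : ℝ) : ℂ) := by
    rw [← integral_complex_ofReal]
    simp_rw [hpt]
    rw [integral_finsetSum _ fun k _ => integrable_finsetSum _ fun l _ => (hint k l).const_mul _]
    simp_rw [integral_finsetSum _ fun l _ => (hint _ l).const_mul _, integral_const_mul,
      hA.isotropic_row, Matrix.one_apply]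
    push_cast
    refine Finset.sum_congr rfl fun k _ => ?_
    simp only [mul_ite, mul_one, mul_zero, Finset.sum_ite_eq, Finset.mem_univ, if_true]
    rw [← Complex.ofReal_pow, ← Complex.normSq_eq_norm_sq, Complex.normSq_eq_conj_mul_self]
    rfl
  exact_mod_cast hc

/-! ### Deterministic core: enough hits imply the null space property -/

/-- The points at which the average of the chosen atoms exceeds, in square, `K² / 2 ^ (i + 3)`. -/
def hitSet {N k : ℕ} (K : ℝ) (i : ℕ) (f : Fin k → Fin N × Fin 4) : Set (Fin N → ℂ) :=
  {x | K ^ 2 / 2 ^ (i + 3) < ‖(k : ℂ)⁻¹ * ∑ r, atomEval (f r) x‖ ^ 2}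

theorem measurableSet_hitSet {N k : ℕ} (K : ℝ) (i : ℕ) (f : Fin k → Fin N × Fin 4) :
    MeasurableSet (hitSet K i f) := by
  have := fun r => measurable_atomEval (f r)
  exact measurableSet_lt measurable_const (by fun_prop)

theorem measureReal_sum_apply {X ι : Type*} [MeasurableSpace X] [Fintype ι] (ρ : ι → Measure X)
    [∀ j, IsFiniteMeasure (ρ j)] {B : Set X} (hB : MeasurableSet B) :
    (Measure.sum ρ).real B = ∑ j, (ρ j).real B := by
  rw [measureReal_def, Measure.sum_apply _ hB, tsum_fintype,
    ENNReal.toReal_sum fun j _ => by finiteness]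
  rfl

/-- If the rows hit every discretised set at least a quarter as often as expected, then no vector
violating the null space property lies in the kernel. -/
theorem IsRandomSamplingMatrix.nullSpaceProperty_of_hits {Ω : Type*} [MeasurableSpace Ω]
    {μ : Measure Ω} [IsProbabilityMeasure μ] {m N s : ℕ} (hm : 0 < m) (hs : 1 ≤ s) {K : ℝ}
    (hK : 0 < K) {A : Ω → Matrix (Fin m) (Fin N) ℂ} (hA : IsRandomSamplingMatrix μ K A)
    {n : ℕ} (hn : 0 < n) (hn2 : 16 * (K ^ 2 * s) ≤ 2 ^ n) (α : ℕ → ℝ)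
    (hα : ∑ i ∈ Finset.range n, α i ≤ 1 / 2) (hα0 : ∀ i, 0 ≤ α i) (θ : ℕ → ℝ)
    (hθ : ∀ i, θ i = α i * 2 ^ i / (8 * (K ^ 2 * s)))
    (k : ℕ → ℕ) (hk : ∀ i, 0 < k i)
    (hkθ : ∀ i < n, 32 * Real.exp (-(k i / 2 ^ (i + 6))) ≤ θ i)
    (ω : Ω) (hω : ∀ j, ‖A ω j‖ ≤ K)
    (hit : ∀ i < n, ∀ f : Fin (k i) → Fin N × Fin 4,
      3 / 4 * (m * θ i) ≤ ∑ j, μ.real ((fun ω => A ω j) ⁻¹' hitSet K i f) →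
      m * θ i / 4 < ∑ j, (hitSet K i f).indicator (fun _ => (1 : ℝ)) (A ω j)) :
    NullSpaceProperty s (A ω) := by
  intro S hS v₀ hv₀ hne
  by_contra! hcon
  have hm' : (0 : ℝ) < m := by exact_mod_cast hm
  have hs' : (0 : ℝ) < s := by exact_mod_cast hs
  -- normalise the kernel vector
  set c : ℝ := ∑ k, (|(v₀ k).re| + |(v₀ k).im|) with hc
  have hc0 : 0 < c := by
    obtain ⟨l, hl⟩ := Function.ne_iff.1 hne
    refine Finset.sum_pos' (fun _ _ => by positivity) ⟨l, Finset.mem_univ l, ?_⟩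
    exact (norm_pos_iff.2 hl).trans_le (Complex.norm_le_abs_re_add_abs_im _)
  set v : Fin N → ℂ := fun l => ((c⁻¹ : ℝ) : ℂ) * v₀ l with hv
  have hv1 : ∑ l, (|(v l).re| + |(v l).im|) = 1 := by
    simp only [hv, Complex.re_ofReal_mul, Complex.im_ofReal_mul, abs_mul, ← mul_add,
      ← Finset.mul_sum, ← hc, abs_of_pos (inv_pos.2 hc0)]
    exact inv_mul_cancel₀ hc0.ne'
  have hvn : ∀ l, ‖v l‖ = c⁻¹ * ‖v₀ l‖ := fun l => by
    rw [hv, norm_mul, Complex.norm_real, Real.norm_eq_abs, abs_of_pos (inv_pos.2 hc0)]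
  have hSv : ∑ l ∈ Sᶜ, ‖v l‖ ≤ ∑ l ∈ S, ‖v l‖ := by
    simp only [hvn, ← Finset.mul_sum]
    exact mul_le_mul_of_nonneg_left hcon (inv_pos.2 hc0).le
  have hker : ∀ j, A ω j ⬝ᵥ v = 0 := by
    intro j
    have h1 : A ω j ⬝ᵥ v₀ = 0 := congrFun hv₀ j
    have h2 : v = ((c⁻¹ : ℝ) : ℂ) • v₀ := rfl
    rw [h2, dotProduct_smul, h1, smul_zero]
  have hnorm := one_le_sum_norm_sq S hS v hv1 hSv
  set σ : ℝ := ∑ l, ‖v l‖ ^ 2 with hσ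
  have hσ0 : 0 ≤ σ := Finset.sum_nonneg fun _ _ => by positivity
  -- the summed population law of the rows
  set ρ : Measure (Fin N → ℂ) := Measure.sum fun j => μ.map fun ω => A ω j with hρ
  have hprob : ∀ j, IsProbabilityMeasure (μ.map fun ω => A ω j) := fun j =>
    Measure.isProbabilityMeasure_map (hA.measurable_row j).aemeasurable
  have hρreal : ∀ B : Set (Fin N → ℂ), MeasurableSet B →
      ρ.real B = ∑ j, μ.real ((fun ω => A ω j) ⁻¹' B) := by
    intro B hB
    rw [hρ, measureReal_sum_apply _ hB]
    exact Finset.sum_congr rfl fun j _ => map_measureReal_apply (hA.measurable_row j) hB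
  have hρuniv : ρ.real Set.univ = m := by
    rw [hρreal _ MeasurableSet.univ]; simp
  have hρK : ∀ᵐ x ∂ρ, ‖x‖ ≤ K := by
    rw [hρ, Measure.ae_sum_iff]
    exact fun j => (ae_map_iff (hA.measurable_row j).aemeasurable
      (measurableSet_le measurable_norm measurable_const)).2 (hA.bounded_row j)
  have hdot : Measurable fun x : Fin N → ℂ => x ⬝ᵥ v := by
    unfold dotProduct; fun_prop
  have hYm : Measurable fun x : Fin N → ℂ => ‖x ⬝ᵥ v‖ ^ 2 := hdot.norm.pow_const 2
  have hYb : ∀ᵐ x ∂ρ, ‖x ⬝ᵥ v‖ ^ 2 ≤ K ^ 2 := hρK.mono fun x hx =>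
    pow_le_pow_left₀ (norm_nonneg _) ((norm_dotProduct_le v x hv1).trans hx) 2
  have hmean : ρ.real Set.univ * σ ≤ ∫ x, ‖x ⬝ᵥ v‖ ^ 2 ∂ρ := by
    have hi : Integrable (fun x => ‖x ⬝ᵥ v‖ ^ 2) ρ := Integrable.of_bound
      hYm.aestronglyMeasurable (K ^ 2) (hYb.mono fun x hx => by simpa using hx)
    rw [hρ, integral_sum_measure hi, tsum_fintype, ← hρ, hρuniv]
    refine le_of_eq ?_
    rw [Finset.sum_congr rfl fun j _ => by
      rw [integral_map (hA.measurable_row j).aemeasurable hYm.aestronglyMeasurable,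
        hA.integral_norm_sq j v, ← hσ]]
    simp
  have hbn : K ^ 2 / 2 ^ n ≤ σ / 2 := by
    rw [div_le_iff₀ (by positivity)]
    have h1 : σ / 2 * (16 * (K ^ 2 * s)) ≤ σ / 2 * 2 ^ n :=
      mul_le_mul_of_nonneg_left hn2 (by positivity)
    have h2 : K ^ 2 * 1 ≤ K ^ 2 * (8 * s * σ) := mul_le_mul_of_nonneg_left hnorm (by positivity)
    linarith
  obtain ⟨i, hi, hlev⟩ := exists_dyadic_level ρ (fun x => ‖x ⬝ᵥ v‖ ^ 2) hYm (sq_nonneg K) hσ0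
    (fun x => by positivity) hYb hmean hn hbn α hα
  rw [hρuniv] at hlev
  -- `θ` is `α i * σ * 2 ^ i / K ^ 2` with `σ` replaced by its lower bound `1 / (8 * s)`, so it no
  -- longer depends on `v`.
  have hlev' : m * θ i ≤ ρ.real {x | K ^ 2 / 2 ^ (i + 1) < ‖x ⬝ᵥ v‖ ^ 2} := by
    rw [div_mul_eq_mul_div, le_div_iff₀ (by positivity)] at hlev
    rw [hθ, mul_div_assoc', div_le_iff₀ (by positivity)]
    have h1 : α i * 2 ^ i * m * 1 ≤ α i * 2 ^ i * m * (8 * s * σ) :=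
      mul_le_mul_of_nonneg_left hnorm (mul_nonneg (mul_nonneg (hα0 i) (by positivity)) hm'.le)
    have h2 := mul_le_mul_of_nonneg_left hlev (show (0 : ℝ) ≤ 8 * s by positivity)
    linarith
  -- discretise against the population law and the sample simultaneously
  set row : Fin m → Fin N → ℂ := A ω with hrow
  set η : Measure (Fin N → ℂ) := Measure.sum fun j => Measure.dirac (row j) with hη
  have hηreal : ∀ B : Set (Fin N → ℂ), MeasurableSet B →
      η.real B = ∑ j, B.indicator (fun _ => (1 : ℝ)) (row j) := by
    intro B hB
    rw [hη, measureReal_sum_apply _ hB]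
    refine Finset.sum_congr rfl fun j _ => ?_
    rw [measureReal_def, Measure.dirac_apply' _ hB]
    by_cases h : row j ∈ B <;> simp [h]
  have hηuniv : η.real Set.univ = m := by
    rw [hηreal _ MeasurableSet.univ]; simp
  have hηK : ∀ᵐ x ∂η, ‖x‖ ≤ K := by
    rw [hη, Measure.ae_sum_iff]
    exact fun j => (ae_dirac_iff (measurableSet_le measurable_norm measurable_const)).2 (hω j)
  -- `2 * t` is the square root of the level `K ^ 2 / 2 ^ (i + 1)`: a value above `2 * t`,
  -- approximated to within `t`, leaves an approximant above `t`.
  set t : ℝ := √(K ^ 2 / 2 ^ (i + 3)) with ht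
  have ht0 : 0 ≤ t := Real.sqrt_nonneg _
  have ht2 : t ^ 2 = K ^ 2 / 2 ^ (i + 3) := Real.sq_sqrt (by positivity)
  have htK : t ≤ K := by
    refine (abs_le_of_sq_le_sq' ?_ hK.le).2
    rw [ht2]
    exact div_le_self (sq_nonneg K) (one_le_pow₀ (by norm_num))
  -- Using `ρ + η` makes one `f` serve both measures. It may depend on the sample, which is harmless
  -- because `hit` covers every `f`.
  obtain ⟨f, hf⟩ := exists_empirical_approx (ρ + η)
    (fun a : Fin N × Fin 4 => quadrantWeight (v a.1) a.2) (fun a => quadrantWeight_nonneg _ _)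
    (by rw [Fintype.sum_prod_type]; simpa only [sum_quadrantWeight] using hv1)
    atomEval measurable_atomEval hK ht0 htK
    ((ae_add_measure_iff.2 ⟨hρK, hηK⟩).mono fun x hx a => (norm_atomEval_le a x).trans hx)
    (k i) (hk i)
  simp only [sum_quadrantWeight_mul_atomEval] at hf
  set W : (Fin N → ℂ) → ℂ := fun x => ((k i : ℕ) : ℂ)⁻¹ * ∑ r, atomEval (f r) x with hW
  set F : Set (Fin N → ℂ) := {x | t ≤ ‖x ⬝ᵥ v - W x‖} with hF
  have hWm : Measurable W := by
    have := fun r => measurable_atomEval (f r)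
    fun_prop
  have hFm : MeasurableSet F := measurableSet_le measurable_const (hdot.sub hWm).norm
  -- The total mass is `2 * m`, so the failure set has measure at most `8 * m * exp (-(k i / 2 ^ (i
  -- + 6)))`; the 32 in `hkθ` is `8 * 4`.
  have hFle : ρ.real F + η.real F ≤ m * θ i / 4 := by
    rw [measureReal_add_apply, measureReal_add_apply, hρuniv, hηuniv] at hf
    have he : -((k i : ℝ) * t ^ 2 / (8 * K ^ 2)) = -(k i / 2 ^ (i + 6)) := by
      rw [ht2]; field_simp; ring
    rw [he] at hf
    have := mul_le_mul_of_nonneg_left (hkθ i hi) hm'.le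
    linarith
  have hρF : 0 ≤ ρ.real F := measureReal_nonneg
  have hηF : 0 ≤ η.real F := measureReal_nonneg
  have hpop : 3 / 4 * (m * θ i) ≤ ρ.real (hitSet K i f) := by
    have hsub : {x | K ^ 2 / 2 ^ (i + 1) < ‖x ⬝ᵥ v‖ ^ 2} ⊆ hitSet K i f ∪ F := by
      intro x hx
      by_contra hx'
      rw [Set.mem_union, not_or] at hx'
      have h1 : ‖W x‖ ≤ t := by
        refine (abs_le_of_sq_le_sq' ?_ ht0).2
        rw [ht2]; exact not_lt.1 hx'.1
      have h2 : ‖x ⬝ᵥ v - W x‖ < t := not_le.1 hx'.2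
      have h3 : ‖x ⬝ᵥ v‖ ≤ 2 * t := by
        have := norm_le_norm_sub_add (x ⬝ᵥ v) (W x)
        linarith
      have h4 := pow_le_pow_left₀ (norm_nonneg _) h3 2
      have h5 : (2 * t) ^ 2 = K ^ 2 / 2 ^ (i + 1) := by
        rw [mul_pow, ht2, pow_add, pow_add]; field_simp
      exact absurd hx (not_lt.2 (h5 ▸ h4))
    have h6 := (measureReal_mono (μ := ρ) hsub).trans (measureReal_union_le _ _)
    linarith
  -- On a sampled row `x ⬝ᵥ v = 0`, so the approximation error is `‖W x‖` itself: every hit is a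
  -- failure.
  have hemp : η.real (hitSet K i f) ≤ η.real F := by
    rw [hηreal _ (measurableSet_hitSet K i f), hηreal _ hFm]
    refine Finset.sum_le_sum fun j _ => ?_
    by_cases hj : row j ∈ hitSet K i f
    · have hjF : row j ∈ F := by
        change t ≤ ‖row j ⬝ᵥ v - W (row j)‖
        rw [hker j, zero_sub, norm_neg]
        refine (abs_le_of_sq_le_sq' ?_ (norm_nonneg _)).2
        rw [ht2]; exact (le_of_lt hj)
      simp [hj, hjF]
    · rw [Set.indicator_of_notMem hj]
      exact Set.indicator_nonneg (fun _ _ => zero_le_one) _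
  rw [hρreal _ (measurableSet_hitSet K i f)] at hpop
  have hfin := hit i hi f hpop
  rw [← hηreal _ (measurableSet_hitSet K i f)] at hfin
  linarith

/-! ### Union bound -/

/-- Union bound over all discretised sets. -/
theorem IsRandomSamplingMatrix.measureReal_not_nullSpaceProperty_le {Ω : Type*}
    [MeasurableSpace Ω] {μ : Measure Ω} [IsProbabilityMeasure μ] {m N s : ℕ} (hm : 0 < m)
    (hs : 1 ≤ s) {K : ℝ} (hK : 0 < K) {A : Ω → Matrix (Fin m) (Fin N) ℂ}
    (hA : IsRandomSamplingMatrix μ K A)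
    {n : ℕ} (hn : 0 < n) (hn2 : 16 * (K ^ 2 * s) ≤ 2 ^ n) (α : ℕ → ℝ)
    (hα : ∑ i ∈ Finset.range n, α i ≤ 1 / 2) (hα0 : ∀ i, 0 ≤ α i) (θ : ℕ → ℝ)
    (hθ : ∀ i, θ i = α i * 2 ^ i / (8 * (K ^ 2 * s)))
    (k : ℕ → ℕ) (hk : ∀ i, 0 < k i)
    (hkθ : ∀ i < n, 32 * Real.exp (-(k i / 2 ^ (i + 6))) ≤ θ i) :
    μ.real {ω | ¬ NullSpaceProperty s (A ω)} ≤
      ∑ i ∈ Finset.range n, (4 * N : ℝ) ^ k i * Real.exp (-(11 / 50 * (m * θ i))) := by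
  classical
  set bad : (i : ℕ) → (Fin (k i) → Fin N × Fin 4) → Set Ω := fun i f =>
    {ω | 3 / 4 * (m * θ i) ≤ ∑ j, μ.real ((fun ω => A ω j) ⁻¹' hitSet K i f) ∧
      ∑ j, (hitSet K i f).indicator (fun _ => (1 : ℝ)) (A ω j) ≤ m * θ i / 4} with hbad
  have hθ0 : ∀ i, 0 ≤ θ i := fun i => by
    rw [hθ]; exact div_nonneg (mul_nonneg (hα0 i) (by positivity)) (by positivity)
  have hbadle : ∀ i f, μ.real (bad i f) ≤ Real.exp (-(11 / 50 * (m * θ i))) := by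
    intro i f
    -- The first condition in `bad` does not involve `ω`; when it fails, the event is empty.
    by_cases h : 3 / 4 * (m * θ i) ≤ ∑ j, μ.real ((fun ω => A ω j) ⁻¹' hitSet K i f)
    · refine (measureReal_mono fun ω hω => ?_).trans (measureReal_sum_indicator_le μ
        (fun j ω => A ω j) hA.measurable_row hA.indep_rows (measurableSet_hitSet K i f)
        (mul_nonneg (Nat.cast_nonneg m) (hθ0 i)) h)
      exact hω.2
    · have : bad i f = ∅ := by
        ext ω; simp only [hbad, Set.mem_ofPred_eq, h, false_and, Set.mem_empty_iff_false]
      rw [this, measureReal_empty]; positivity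
  have hnull : μ.real {ω | ¬ ∀ j, ‖A ω j‖ ≤ K} = 0 := by
    rw [measureReal_def, ae_iff.1 (ae_all_iff.2 hA.bounded_row), ENNReal.toReal_zero]
  have hsub : {ω | ¬ NullSpaceProperty s (A ω)} ⊆
      {ω | ¬ ∀ j, ‖A ω j‖ ≤ K} ∪ ⋃ i ∈ Finset.range n, ⋃ f ∈ Finset.univ, bad i f := by
    intro ω hω
    by_contra hcon
    rw [Set.mem_union, not_or] at hcon
    obtain ⟨h1, h2⟩ := hcon
    refine hω (hA.nullSpaceProperty_of_hits hm hs hK hn hn2 α hα hα0 θ hθ k hk hkθ ω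
      (not_not.1 h1) fun i hi f hf => ?_)
    by_contra h3
    exact h2 (Set.mem_biUnion (Finset.mem_coe.2 (Finset.mem_range.2 hi))
      (Set.mem_biUnion (Finset.mem_coe.2 (Finset.mem_univ f)) ⟨hf, not_lt.1 h3⟩))
  calc μ.real {ω | ¬ NullSpaceProperty s (A ω)}
      ≤ μ.real {ω | ¬ ∀ j, ‖A ω j‖ ≤ K} +
          μ.real (⋃ i ∈ Finset.range n, ⋃ f ∈ Finset.univ, bad i f) :=
        (measureReal_mono hsub).trans (measureReal_union_le _ _)
    _ ≤ 0 + ∑ i ∈ Finset.range n, ∑ f, μ.real (bad i f) := by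
        rw [hnull]
        gcongr
        refine (measureReal_biUnion_finset_le _ _).trans (Finset.sum_le_sum fun i _ => ?_)
        exact measureReal_biUnion_finset_le _ _
    _ ≤ ∑ i ∈ Finset.range n, ∑ _f : Fin (k i) → Fin N × Fin 4,
          Real.exp (-(11 / 50 * (m * θ i))) := by
        rw [zero_add]
        exact Finset.sum_le_sum fun i _ => Finset.sum_le_sum fun f _ => hbadle i f
    _ = _ := by
        refine Finset.sum_congr rfl fun i _ => ?_
        rw [Finset.sum_const, nsmul_eq_mul, Finset.card_univ, Fintype.card_fun, Fintype.card_prod,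
          Fintype.card_fin, Fintype.card_fin, Fintype.card_fin]
        push_cast
        rw [mul_comm (N : ℝ) 4]

/-! ### Numerical constants and the exponent–entropy comparison -/

theorem four_div_sqrt_sq : (4 / √41 : ℝ) ^ 2 = 16 / 41 := by
  rw [div_pow, Real.sq_sqrt (by norm_num)]; norm_num

theorem three_fifths_le_four_div_sqrt : (3 / 5 : ℝ) ≤ 4 / √41 := by
  refine (abs_le_of_sq_le_sq' ?_ (by positivity)).2
  rw [four_div_sqrt_sq]; norm_num

theorem sqrt_exp_one_ge : (8 / 5 : ℝ) ≤ √(Real.exp 1) := by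
  refine Real.le_sqrt_of_sq_le ?_
  have := Real.exp_one_gt_d9
  norm_num at this ⊢
  linarith

/-- The factor `lam⁻²` only helps. The value 2100 leaves room above `2048 * exp (1 / 64)`, needed
for the choice of `k`. -/
theorem samplingD_ge {lam : ℝ} (h0 : 0 < lam) (h1 : lam < 1) :
    2100 ≤ samplingD (4 / √41) lam := by
  have hδ := three_fifths_le_four_div_sqrt
  have hse := sqrt_exp_one_ge
  have he1 := Real.exp_one_gt_d9
  have he : 4.3 ≤ Real.exp (3 / 2) := by
    rw [show (3 / 2 : ℝ) = 1 + 1 / 2 by norm_num, Real.exp_add, Real.exp_half]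
    nlinarith
  have hl : lam ^ 2 ≤ 1 := pow_le_one₀ h0.le h1.le
  have hl0 : 0 < lam ^ 2 := by positivity
  have h2 : 2 * (64 * 4.3 * 2.2) ≤ 2 * (2 ^ 6 * Real.exp (3 / 2) * (4 / √41 + √(Real.exp 1))) := by
    have : (4.3 : ℝ) * 2.2 ≤ Real.exp (3 / 2) * (4 / √41 + √(Real.exp 1)) :=
      mul_le_mul he (by linarith) (by norm_num) (Real.exp_pos _).le
    linarith
  have h3 : (16 / 41 : ℝ) * lam ^ 2 ≤ 16 / 41 := by linarith
  rw [samplingD, samplingC₂, mul_pow, four_div_sqrt_sq, mul_div_assoc', le_div_iff₀ (by positivity)]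
  refine le_trans ?_ h2
  linarith

/-- The factor `(1 - lam)⁻²` only helps, and the remaining numerical estimates give about 38400. -/
theorem samplingC_sq_ge {lam : ℝ} (h0 : 0 < lam) (h1 : lam < 1) :
    0 < samplingC (4 / √41) lam ∧ 38000 ≤ samplingC (4 / √41) lam ^ 2 := by
  have hδ := three_fifths_le_four_div_sqrt
  have hse := sqrt_exp_one_ge
  have hl2 := Real.log_two_lt_d9
  have hl20 : 0 < Real.log 2 := Real.log_pos (by norm_num)
  have h1l : 0 < 1 - lam := by linarith
  have hlam : (1 - lam) ^ 2 ≤ 1 := pow_le_one₀ h1l.le (by linarith)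
  constructor
  · unfold samplingC samplingC₁; positivity
  have hexp : Real.exp (1 / 4) ^ 2 = √(Real.exp 1) := by
    rw [← Real.exp_half, ← Real.exp_nat_mul]; norm_num
  have hsq : samplingC (4 / √41) lam ^ 2 = 2048 * √(Real.exp 1) * (√(Real.exp 1) + 4 / √41) /
      (Real.log 2 ^ 2 * ((1 - lam) ^ 2 * (16 / 41))) := by
    rw [samplingC, samplingC₁, mul_pow, mul_pow, div_pow, div_pow, mul_pow, hexp, mul_pow,
      four_div_sqrt_sq, Real.sq_sqrt (by norm_num : (0 : ℝ) ≤ 2), Real.sq_sqrt (by positivity)]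
    field_simp
    ring
  rw [hsq, le_div_iff₀ (by positivity)]
  have hlog : Real.log 2 ^ 2 ≤ 0.48053 := by nlinarith
  have h2 : Real.log 2 ^ 2 * ((1 - lam) ^ 2 * (16 / 41)) ≤ 0.48053 * (1 * (16 / 41)) := by gcongr
  have h3 : (8 / 5 : ℝ) * (11 / 5) ≤ √(Real.exp 1) * (√(Real.exp 1) + 4 / √41) :=
    mul_le_mul hse (by linarith) (by norm_num) (Real.sqrt_nonneg _)
  nlinarith

/-- Squaring the sample-size hypothesis. -/
theorem sampleSize_lower_bound {m C K s p Λ y E : ℝ} (hm0 : 0 ≤ m) (hC0 : 0 < C)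
    (hC : 38000 ≤ C ^ 2) (hK : 0 ≤ K) (hs : 0 ≤ s) (hp : 0 ≤ p) (hΛ : 0 ≤ Λ) (hy : 0 ≤ y)
    (hE : 0 ≤ E) (hm : √m > C * K * √s * √p * Λ * √y + C * K * √s * √E) :
    38000 * (K ^ 2 * s) * (p * Λ ^ 2 * y + E) ≤ m := by
  set a := K * √s * √p * Λ * √y with ha
  set b := K * √s * √E with hb
  have ha0 : 0 ≤ a := by positivity
  have hb0 : 0 ≤ b := by positivity
  have h1 : C * (a + b) ≤ √m := by rw [ha, hb]; linarith
  have h2 := pow_le_pow_left₀ (mul_nonneg hC0.le (add_nonneg ha0 hb0)) h1 2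
  rw [Real.sq_sqrt hm0, mul_pow] at h2
  have ha2 : a ^ 2 = K ^ 2 * s * (p * Λ ^ 2 * y) := by
    rw [ha]; simp only [mul_pow, Real.sq_sqrt hs, Real.sq_sqrt hp, Real.sq_sqrt hy]; ring
  have hb2 : b ^ 2 = K ^ 2 * s * E := by
    rw [hb]; simp only [mul_pow, Real.sq_sqrt hs, Real.sq_sqrt hE]
  have h3 : 38000 * (a + b) ^ 2 ≤ C ^ 2 * (a + b) ^ 2 :=
    mul_le_mul_of_nonneg_right hC (sq_nonneg _)
  nlinarith [mul_nonneg ha0 hb0]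

/-- The exponent at each dyadic level beats the entropy of the discretisation. -/
theorem entropy_le_exponent {m L p Λ y E n x u k l4N : ℝ} (hL : 0 < L) (hx : 0 ≤ x)
    (hp : x + 0.519 ≤ p) (hΛ : x + 7.6 ≤ Λ) (hn0 : 1 ≤ n) (hn : n ≤ 1.4429 * x + 5) (hu : 1 ≤ u)
    (hy : 1 ≤ y) (hE : 0 ≤ E) (hk : k ≤ 64 * u * Λ) (h4 : 2 ≤ l4N) (h4N : l4N ≤ (2 + p) * y)
    (hm : 38000 * L * (p * Λ ^ 2 * y + E) ≤ m) :
    k * l4N + Real.log n + E ≤ 11 / 50 * (m * ((1 / (4 * n) + 1 / (8 * u)) * u / (8 * L))) := by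
  have hΛ0 : 0 < Λ := by linarith
  have hp0 : 0 < p := by linarith
  have hn' : 0 < n := by linarith
  have hu' : 0 < u := by linarith
  -- Choosing the level costs at most one more unit of `u * Λ * l4N`, which turns 64 into 65 below.
  have hlogn : Real.log n ≤ u * Λ * l4N := by
    have h1 := Real.log_le_sub_one_of_pos hn'
    have h2 : Λ * 2 ≤ Λ * l4N := mul_le_mul_of_nonneg_left h4 hΛ0.le
    have h3 : 1 * (Λ * l4N) ≤ u * (Λ * l4N) := mul_le_mul_of_nonneg_right hu (by positivity)
    linarith
  have hkl : k * l4N ≤ 64 * u * Λ * l4N := mul_le_mul_of_nonneg_right hk (by linarith)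
  have hcore : 65 * (2 + p) * n ≤ 261 * p * Λ := by
    have h1 : 65 * (2 + p) * n ≤ 65 * (2 + p) * (1.4429 * x + 5) :=
      mul_le_mul_of_nonneg_left hn (by positivity)
    have h2 : 261 * p * (x + 7.6) ≤ 261 * p * Λ := mul_le_mul_of_nonneg_left hΛ (by positivity)
    nlinarith [mul_nonneg hx hx, mul_nonneg hx (sub_nonneg.2 hp)]
  have hmain : 65 * u * Λ * l4N ≤ 261 * p * Λ ^ 2 * y * u / n := by
    rw [le_div_iff₀ hn']
    calc 65 * u * Λ * l4N * n ≤ 65 * u * Λ * ((2 + p) * y) * n := by gcongr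
      _ = u * Λ * y * (65 * (2 + p) * n) := by ring
      _ ≤ u * Λ * y * (261 * p * Λ) := mul_le_mul_of_nonneg_left hcore (by positivity)
      _ = _ := by ring
  have hc : 0 ≤ (1 / (4 * n) + 1 / (8 * u)) * u / (8 * L) := by positivity
  have hlow := mul_le_mul_of_nonneg_right hm hc
  have heq : 38000 * L * (p * Λ ^ 2 * y + E) * ((1 / (4 * n) + 1 / (8 * u)) * u / (8 * L)) =
      4750 * (p * Λ ^ 2 * y + E) * (u / (4 * n) + 1 / 8) := by
    field_simp; ring
  -- The flat weight `1 / (4 * n)` pays for the entropy: `11 / 50 * 4750 / 4 = 261.25` exceeds the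
  -- 261 of `hmain`. The geometric weight pays for `E`, since `11 / 50 * 4750 / 8 > 1`.
  have hexp : 4750 * (p * Λ ^ 2 * y + E) * (u / (4 * n) + 1 / 8) =
      4750 / 4 * (p * Λ ^ 2 * y * u / n) + 4750 / 8 * (p * Λ ^ 2 * y) + 4750 * E * (u / (4 * n))
        + 4750 / 8 * E := by
    field_simp; ring
  have h1 : 0 ≤ p * Λ ^ 2 * y := by positivity
  have h2 : 0 ≤ 4750 * E * (u / (4 * n)) := by positivity
  have h3 : 261 * p * Λ ^ 2 * y * u / n = 261 * (p * Λ ^ 2 * y * u / n) := by ring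
  have h4' : 0 ≤ p * Λ ^ 2 * y * u / n := by positivity
  linarith

/-- Each kind of weight contributes at most `1 / 4`. The flat part gives `θ i` growth like `2 ^ i /
n`, matching the growth of `k i`; the geometric part keeps `θ i` at least `1 / (64 * L)`. -/
theorem sum_level_weights_le {n : ℕ} (hn : 0 < n) :
    ∑ i ∈ Finset.range n, (1 / (4 * (n : ℝ)) + 1 / (8 * 2 ^ i)) ≤ 1 / 2 := by
  have hn' : (0 : ℝ) < n := by exact_mod_cast hn
  have h : ∀ k : ℕ, ∑ i ∈ Finset.range k, 1 / (8 * (2 : ℝ) ^ i) = 1 / 4 - 1 / (4 * 2 ^ k) := by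
    intro k
    induction k with
    | zero => norm_num
    | succ k ih => rw [Finset.sum_range_succ, ih, pow_succ]; field_simp; ring
  rw [Finset.sum_add_distrib, h, Finset.sum_const, Finset.card_range, nsmul_eq_mul]
  have h1 : (n : ℝ) * (1 / (4 * n)) = 1 / 4 := by field_simp
  have h2 : 0 ≤ 1 / (4 * (2 : ℝ) ^ n) := by positivity
  linarith

/-! ### Choice of parameters and conclusion -/

theorem mainTheorem3 {Ω : Type*} [MeasurableSpace Ω] (μ : Measure Ω) [IsProbabilityMeasure μ]
    (m N s : ℕ) (hs : 1 ≤ s) (K : ℝ) (hK : 1 ≤ K)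
    (hN : 4 * samplingP K s < (N : ℝ))
    (A : Ω → Matrix (Fin m) (Fin N) ℂ) (hA : IsRandomSamplingMatrix μ K A)
    (ε lam : ℝ) (hε₀ : 0 < ε) (hε₁ : ε < 1) (hlam₀ : 0 < lam) (hlam₁ : lam < 1)
    (hm : √(m : ℝ) >
      samplingC (4 / √41) lam * K * √(s : ℝ) * √(Real.log ((2 : ℝ) ^ (3 / 4 : ℝ) * K ^ 2 * s)) *
          Real.log (samplingD (4 / √41) lam * K ^ 2 * s) *
          √(Real.log ((N : ℝ) / samplingP K s)) +
        samplingC (4 / √41) lam * K * √(s : ℝ) * √(Real.log (1 / ε))) :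
    1 - ε ≤ μ.real {ω | NullSpaceProperty s ((1 / √(m : ℝ)) • A ω)} := by
  have hs' : (1 : ℝ) ≤ s := by exact_mod_cast hs
  have hK0 : 0 < K := by linarith
  set L : ℝ := K ^ 2 * s with hL
  have hL1 : 1 ≤ L := one_le_mul_of_one_le_of_one_le (one_le_pow₀ hK) hs'
  have hL0 : 0 < L := by linarith
  set x : ℝ := Real.log L with hx
  have hx0 : 0 ≤ x := Real.log_nonneg hL1
  have hlog2 := Real.log_two_gt_d9
  have hlog2' := Real.log_two_lt_d9
  set p : ℝ := samplingP K s with hp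
  have hpx : p = 3 / 4 * Real.log 2 + x := by
    rw [hp, samplingP, mul_assoc, ← hL, Real.log_mul (by positivity) hL0.ne',
      Real.log_rpow (by norm_num)]
  have hp1 : x + 0.519 ≤ p := by rw [hpx]; linarith
  have hp0 : 0 < p := by linarith
  set D : ℝ := samplingD (4 / √41) lam with hD
  have hD1 : 2100 ≤ D := samplingD_ge hlam₀ hlam₁
  set Λ : ℝ := Real.log (D * L) with hΛ
  have hΛ' : Real.log (D * K ^ 2 * s) = Λ := by rw [hΛ, hL, mul_assoc]
  have hk0 : Real.log (2048 * L) = 11 * Real.log 2 + x := by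
    rw [Real.log_mul (by norm_num) hL0.ne', show (2048 : ℝ) = 2 ^ 11 by norm_num, Real.log_pow]
    norm_num [hx]
  -- The slack `1 / 64`, multiplied by `64 * 2 ^ i ≥ 1`, absorbs the rounding up in `k i`.
  have hΛ1 : Real.log (2048 * L) + 1 / 64 ≤ Λ := by
    have h1 : Real.exp (1 / 64) ≤ 2100 / 2048 := by
      have := (abs_le.1 (Real.abs_exp_sub_one_sub_id_le (x := 1 / 64) (by norm_num [abs_le]))).2
      norm_num at this ⊢
      linarith
    rw [hΛ, Real.le_log_iff_exp_le (by positivity), Real.exp_add, Real.exp_log (by positivity)]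
    calc 2048 * L * Real.exp (1 / 64) ≤ 2048 * L * (2100 / 2048) := by gcongr
      _ = 2100 * L := by ring
      _ ≤ D * L := by gcongr
  have hΛ2 : x + 7.6 ≤ Λ := by linarith
  set y : ℝ := Real.log (N / p) with hy
  have hN0 : (0 : ℝ) < N := by linarith
  have hNy : (4 : ℝ) ≤ N / p := by rw [le_div_iff₀ hp0]; exact hN.le
  have hlog4 : Real.log 4 = 2 * Real.log 2 := by
    rw [show (4 : ℝ) = 2 ^ 2 by norm_num, Real.log_pow]; norm_num
  have hy4 : Real.log 4 ≤ y := Real.log_le_log (by norm_num) hNy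
  have hy1 : 1 ≤ y := by linarith
  set E : ℝ := Real.log (1 / ε) with hE
  have hE0 : 0 ≤ E := Real.log_nonneg (by rw [le_div_iff₀ hε₀]; linarith)
  obtain ⟨hC0, hC⟩ := samplingC_sq_ge hlam₀ hlam₁
  have hmL : 38000 * L * (p * Λ ^ 2 * y + E) ≤ m :=
    sampleSize_lower_bound (Nat.cast_nonneg m) hC0 hC hK0.le (by linarith) hp0.le (by linarith)
      (by linarith) hE0 (by rw [hΛ'] at hm; exact hm)
  have hΛ0 : 0 < Λ := by linarith
  have hm0 : (0 : ℝ) < m := lt_of_lt_of_le (by positivity) hmL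
  have hmpos : 0 < m := by exact_mod_cast hm0
  -- the number of dyadic levels
  obtain ⟨n, hn0, hn2, hnx⟩ : ∃ n : ℕ, 0 < n ∧ 16 * L ≤ 2 ^ n ∧ (n : ℝ) ≤ 1.4429 * x + 5 := by
    have hlb : Real.log (16 * L) = 4 * Real.log 2 + x := by
      rw [Real.log_mul (by norm_num) hL0.ne', show (16 : ℝ) = 2 ^ 4 by norm_num, Real.log_pow]
      norm_num [hx]
    set z : ℝ := Real.log (16 * L) / Real.log 2 with hz
    have hz4 : z = 4 + x / Real.log 2 := by rw [hz, hlb]; field_simp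
    have hxd : x / Real.log 2 ≤ 1.4429 * x := by
      rw [div_le_iff₀ (by linarith)]; nlinarith
    have hxd0 : 0 ≤ x / Real.log 2 := by positivity
    -- In the bound on `n`, 1.4429 exceeds `1 / log 2`, and 5 is `log₂ 16` plus 1 for the ceiling.
    refine ⟨⌈z⌉₊, Nat.ceil_pos.2 (by linarith), ?_, ?_⟩
    · rw [← Real.log_le_log_iff (by positivity) (by positivity), Real.log_pow]
      have := Nat.le_ceil z
      rw [hz, div_le_iff₀ (by linarith)] at this
      exact this
    · have := Nat.ceil_lt_add_one (show 0 ≤ z by linarith)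
      linarith
  have hn1 : (1 : ℝ) ≤ n := by exact_mod_cast hn0
  set α : ℕ → ℝ := fun i => 1 / (4 * (n : ℝ)) + 1 / (8 * 2 ^ i) with hα
  set θ : ℕ → ℝ := fun i => α i * 2 ^ i / (8 * L) with hθ
  -- This makes `32 * exp (-(k i / 2 ^ (i + 6)))` at most `32 / (2048 * L) = 1 / (64 * L)`, the
  -- lower bound for `θ i`.
  set k : ℕ → ℕ := fun i => ⌈2 ^ (i + 6) * Real.log (2048 * L)⌉₊ with hk
  have hlogpos : 0 < Real.log (2048 * L) := by rw [hk0]; linarith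
  have hkpos : ∀ i, 0 < k i := fun i => Nat.ceil_pos.2 (by positivity)
  have hkθ : ∀ i < n, 32 * Real.exp (-(k i / 2 ^ (i + 6))) ≤ θ i := by
    intro i _
    have h1 : Real.log (2048 * L) ≤ k i / 2 ^ (i + 6) := by
      rw [le_div_iff₀ (by positivity), mul_comm]
      exact Nat.le_ceil _
    have h2 : Real.exp (-(k i / 2 ^ (i + 6))) ≤ (2048 * L)⁻¹ := by
      rw [← Real.exp_log (show 0 < 2048 * L by positivity), ← Real.exp_neg]
      exact Real.exp_le_exp.2 (neg_le_neg h1)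
    have h3 : 1 / 8 ≤ α i * 2 ^ i := by
      have : α i * 2 ^ i = 2 ^ i / (4 * n) + 1 / 8 := by simp only [hα]; field_simp
      rw [this]
      have : (0 : ℝ) ≤ 2 ^ i / (4 * n) := by positivity
      linarith
    calc 32 * Real.exp (-(k i / 2 ^ (i + 6))) ≤ 32 * (2048 * L)⁻¹ := by gcongr
      _ = 1 / 8 / (8 * L) := by field_simp; norm_num
      _ ≤ θ i := by simp only [hθ]; gcongr
  have hbound := hA.measureReal_not_nullSpaceProperty_le hmpos hs hK0 hn0 hn2 α
    (sum_level_weights_le hn0) (fun i => by positivity) θ (fun i => rfl) k hkpos hkθ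
  -- logarithm of the size of the family of atoms
  have hlogN : Real.log (4 * N) ≤ (2 + p) * y := by
    have h1 : Real.log (4 * N) = Real.log 4 + (y + Real.log p) := by
      rw [hy, Real.log_div hN0.ne' hp0.ne', Real.log_mul (by norm_num) hN0.ne']; ring
    -- `N > 4 * p` gives `log 4 ≤ y` and `1 ≤ y`, so `log 4 + y + log p` is at most `2 * y + p * y`.
    have h2 := Real.log_le_sub_one_of_pos hp0
    have h3 := mul_le_mul_of_nonneg_left hy1 hp0.le
    rw [h1, add_mul]
    linarith
  have hlogN2 : 2 ≤ Real.log (4 * N) := by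
    have h1 : Real.log (2 ^ 3) ≤ Real.log (4 * N) :=
      Real.log_le_log (by norm_num) (by norm_num; linarith)
    rw [Real.log_pow] at h1
    norm_num at h1
    linarith
  have hterm : ∀ i ∈ Finset.range n,
      (4 * N : ℝ) ^ k i * Real.exp (-(11 / 50 * (m * θ i))) ≤ ε / n := by
    intro i _
    have hu : (1 : ℝ) ≤ 2 ^ i := one_le_pow₀ (by norm_num)
    have hki : (k i : ℝ) ≤ 64 * 2 ^ i * Λ := by
      have h1 : (k i : ℝ) < 2 ^ (i + 6) * Real.log (2048 * L) + 1 :=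
        Nat.ceil_lt_add_one (by positivity)
      have h2 : (64 : ℝ) * 2 ^ i * (Real.log (2048 * L) + 1 / 64) ≤ 64 * 2 ^ i * Λ := by gcongr
      rw [pow_add] at h1
      norm_num at h1
      linarith
    have hexp := entropy_le_exponent hL0 hx0 hp1 hΛ2 hn1 hnx hu hy1 hE0 hki hlogN2 hlogN hmL
    have hEε : Real.exp (-E) = ε := by
      rw [hE, one_div, Real.log_inv, neg_neg, Real.exp_log hε₀]
    calc (4 * N : ℝ) ^ k i * Real.exp (-(11 / 50 * (m * θ i)))
        = Real.exp (k i * Real.log (4 * N) - 11 / 50 * (m * θ i)) := by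
          rw [sub_eq_add_neg, Real.exp_add, Real.exp_nat_mul, Real.exp_log (by positivity)]
      _ ≤ Real.exp (-E - Real.log n) := Real.exp_le_exp.2 (by simp only [hθ, hα]; linarith)
      _ = ε / n := by rw [Real.exp_sub, hEε, Real.exp_log (by linarith)]
  have hbad : μ.real {ω | ¬ NullSpaceProperty s (A ω)} ≤ ε := by
    refine hbound.trans ((Finset.sum_le_sum hterm).trans (le_of_eq ?_))
    rw [Finset.sum_const, Finset.card_range, nsmul_eq_mul]
    field_simp
  have hscale : ∀ ω, NullSpaceProperty s (A ω) →
      NullSpaceProperty s ((1 / √(m : ℝ)) • A ω) := by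
    intro ω h S hS v hv
    refine h S hS v ?_
    rw [Matrix.smul_mulVec] at hv
    exact (smul_eq_zero.1 hv).resolve_left (by positivity)
  -- Covering and subadditivity replace passing to the complement, so measurability of the event is
  -- not needed.
  have hcover : (Set.univ : Set Ω) ⊆ {ω | NullSpaceProperty s ((1 / √(m : ℝ)) • A ω)} ∪
      {ω | ¬ NullSpaceProperty s (A ω)} := fun ω _ =>
    (em (NullSpaceProperty s (A ω))).imp (hscale ω) id
  have htotal := (measureReal_mono (μ := μ) hcover).trans (measureReal_union_le _ _)
  rw [probReal_univ] at htotal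
  linarith
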